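/- Let $d\ge 1$ and let $G$ be a measure on $(0,\infty)$ whose tail $\bar G(u)=G((u,\infty))$ is finite for every $u>0$. Let $h:\mathbb R^d\to[0,\infty]$ be measurable, let $\Phi$ be a Poisson point process on $\mathbb R^d\times(0,\infty)$ with intensity $dx\,G(dm)$ on a probability space $(\Omega,\mathcal F,\mathbb P)$, and let $$M(y)=\sup\{m\,h(y-x):(x,m)\in\Phi\}\in[0,\infty],\qquad y\in\mathbb R^d,$$ be the associated extremal shot noise (with $\sup\emptyset=0$). Put $$\alpha(h,G)=\inf\Big\{u\in(0,\infty):\int_{\mathbb R^d}\bar G(u/h(x))\,dx<\infty\Big\},\qquad \inf\emptyset=+\infty,$$ where $\bar G(u/h(x))$ is read as $0$ if $h(x)=0$ and as $G((0,\infty))$ if $h(x)=\infty$; put $\alpha^+(h,G)=\alpha(h^+,G)$ with $h^+(x)=\sup_{|z|\le1}h(x+z)$, and $\alpha^-(h,G)=\lim_{\varepsilon\downarrow0}\alpha(h^-_\varepsilon,G)$ with $h^-_\varepsilon(x)=\inf_{|z|\le\varepsilon}h(x+z)$. For a space $X$ of functions on $\mathbb R^d$ with a $\sigma$-field and the shifts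 $\tau_vf=f(\cdot+v)$, a random element $M$ of $X$ is called stationary if $\tau_vM$ has the same law as $M$ for every $v\in\mathbb R^d$. A stationary $M$ is called $\alpha$-mixing in $X$ if $$\lim_{|v|\to\infty}\mathbb P(M\in A,\ \tau_vM\in B)=\mathbb P(M\in A)\,\mathbb P(M\in B)$$ for all measurable $A,B\subseteq X$, and ergodic if $\mathbb P(M\in A)\in\{0,1\}$ for every measurable $A\subseteq X$ such that, for each $v\in\mathbb R^d$, almost surely $\tau_vM\in A\Leftrightarrow M\in A$. 1. $M$ is stationary and $\alpha$-mixing, hence ergodic, in $[0,\infty]^{\mathbb R^d}$ with the product $\sigma$-field. 2. If in addition $h$ is continuous and $\alpha^-(h,G)=\alpha^+(h,G)$, then $M$ almost surely has continuous paths and, considered (after modification on a null event) as a random element of $C(\mathbb R^d,[0,\infty])$ with the topology of uniform convergence on compact sets and its Borel $\sigma$-field, it is stationary and $\alpha$-mixing, hence ergodic. -/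

import Mathlib

open MeasureTheory ProbabilityTheory Filter Topology Set
open scoped ENNReal NNReal

noncomputable section

namespace ShotNoise

/-- The Euclidean space `ℝ^d`. -/
abbrev E (d : ℕ) : Type := EuclideanSpace ℝ (Fin d)

/-- The half-line `(0, +∞)` of weights. -/
abbrev Weight : Type := Set.Ioi (0 : ℝ)

/-- The number of points of the configuration `N` lying in `B`. -/
def count {S : Type*} (N B : Set S) : ℕ∞ := (N ∩ B).encard

/-- `Φ` is a (simple) Poisson point process on `S` with intensity measure `ν`, defined on the
probability space `(Ω, P)`: a random locally finite subset of `S` whose numbers of points in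
Borel sets are measurable, Poisson distributed with mean `ν B` (a.s. infinite when `ν B = ∞`),
and independent for pairwise disjoint Borel sets. -/
structure IsPoissonPointProcess {Ω S : Type*} [MeasurableSpace Ω] [TopologicalSpace S]
    [MeasurableSpace S] (Φ : Ω → Set S) (ν : Measure S) (P : Measure Ω) : Prop where
  locallyFinite : ∀ ω, ∀ K : Set S, IsCompact K → (Φ ω ∩ K).Finite
  measurable_count : ∀ B : Set S, MeasurableSet B → Measurable fun ω => count (Φ ω) B
  law_count : ∀ B : Set S, MeasurableSet B → ν B ≠ ∞ →
    P.map (fun ω => count (Φ ω) B) = (poissonMeasure (ν B).toNNReal).map (Nat.cast : ℕ → ℕ∞)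
  count_eq_top : ∀ B : Set S, MeasurableSet B → ν B = ∞ → ∀ᵐ ω ∂P, count (Φ ω) B = ⊤
  indep : ∀ (n : ℕ) (B : Fin n → Set S), (∀ i, MeasurableSet (B i)) →
    Pairwise (fun i j => Disjoint (B i) (B j)) →
    iIndepFun (fun i ω => count (Φ ω) (B i)) P

/-- The extremal shot noise field `M(y) = sup {m h(y - x) ; (x, m) ∈ N}` of a configuration `N`
(the supremum of the empty set is `0`). -/
def shotNoise {d : ℕ} (h : E d → ℝ≥0∞) (N : Set (E d × Weight)) (y : E d) : ℝ≥0∞ :=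
  ⨆ φ ∈ N, ENNReal.ofReal (φ.2 : ℝ) * h (y - φ.1)

/-- The tail function `u ↦ G((u, +∞))`, for `u ∈ [0, +∞]`. -/
def tail (G : Measure Weight) (u : ℝ≥0∞) : ℝ≥0∞ :=
  G {m | u < ENNReal.ofReal (m : ℝ)}

/-- The coefficient `α(h, G)`, the infimum of all `u ∈ (0, +∞)` for which
`∫ tail G (u / h(x)) dx < ∞`; it is `+∞` if there is no such `u`. In `[0, +∞]`, for
`0 < u < +∞`, one has `u / 0 = +∞` and `u / +∞ = 0`, so that the integrand is `0` where `h = 0`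
and `G((0, +∞))` where `h = +∞`. -/
def alpha {d : ℕ} (h : E d → ℝ≥0∞) (G : Measure Weight) : ℝ≥0∞ :=
  sInf {u : ℝ≥0∞ | 0 < u ∧ u < ∞ ∧ ∫⁻ x, tail G (u / h x) < ∞}

/-- `h⁺(x) = sup {h(x + z) ; |z| ≤ 1}`. -/
def hPlus {d : ℕ} (h : E d → ℝ≥0∞) (x : E d) : ℝ≥0∞ :=
  ⨆ z ∈ {z : E d | ‖z‖ ≤ 1}, h (x + z)

/-- `α⁺(h, G) = α(h⁺, G)`. -/
def alphaPlus {d : ℕ} (h : E d → ℝ≥0∞) (G : Measure Weight) : ℝ≥0∞ :=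
  alpha (hPlus h) G

/-- `h⁻_ε(x) = inf {h(x + z) ; |z| ≤ ε}`. -/
def hMinus {d : ℕ} (h : E d → ℝ≥0∞) (ε : ℝ) (x : E d) : ℝ≥0∞ :=
  ⨅ z ∈ {z : E d | ‖z‖ ≤ ε}, h (x + z)

/-- `α⁻(h, G)`, the limit of `α(h⁻_ε, G)` as `ε ↓ 0`. The function of `ε` is nonincreasing, so
the limit is a supremum; see `tendsto_alphaMinus`. -/
def alphaMinus {d : ℕ} (h : E d → ℝ≥0∞) (G : Measure Weight) : ℝ≥0∞ :=
  ⨆ ε ∈ Set.Ioi (0 : ℝ), alpha (hMinus h ε) G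

theorem alpha_mono {d : ℕ} {h₁ h₂ : E d → ℝ≥0∞} (hle : ∀ x, h₁ x ≤ h₂ x) (G : Measure Weight) :
    alpha h₁ G ≤ alpha h₂ G := by
  refine sInf_le_sInf ?_
  rintro u ⟨h0, h1, h2⟩
  refine ⟨h0, h1, lt_of_le_of_lt (lintegral_mono fun x => ?_) h2⟩
  exact measure_mono fun m hm => lt_of_le_of_lt (ENNReal.div_le_div_left (hle x) u) hm

theorem tendsto_alphaMinus {d : ℕ} (h : E d → ℝ≥0∞) (G : Measure Weight) :
    Tendsto (fun ε : ℝ => alpha (hMinus h ε) G) (𝓝[>] 0) (𝓝 (alphaMinus h G)) := by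
  have hanti : Antitone fun ε : ℝ => alpha (hMinus h ε) G := fun a b hab =>
    alpha_mono (fun x => biInf_mono fun z (hz : ‖z‖ ≤ a) => hz.trans hab) G
  have := hanti.tendsto_nhdsGT 0
  rwa [sSup_image] at this

/-- The Borel `σ`-field of `C(ℝ^d, [0, +∞])`, for the topology of uniform convergence on compact
sets (the compact-open topology). The space `ℝ^d → [0, +∞]` carries the product `σ`-field. -/
instance instMeasurableSpaceC (d : ℕ) : MeasurableSpace C(E d, ℝ≥0∞) := borel _

instance instBorelSpaceC (d : ℕ) : BorelSpace C(E d, ℝ≥0∞) := ⟨rfl⟩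

/-- The shift `τ_v f = f(· + v)` on `[0, +∞]^{ℝ^d}`. -/
def shift {d : ℕ} (v : E d) (f : E d → ℝ≥0∞) : E d → ℝ≥0∞ := fun y => f (y + v)

/-- The shift `τ_v f = f(· + v)` on `C(ℝ^d, [0, +∞])`. -/
def shiftC {d : ℕ} (v : E d) (f : C(E d, ℝ≥0∞)) : C(E d, ℝ≥0∞) :=
  ⟨fun y => f (y + v), by fun_prop⟩

/-- `M` is a random element of the measurable space `X` whose law is invariant under all the
shifts `τ v`, `v ∈ ℝ^d`. -/
structure IsStationary {d : ℕ} {Ω X : Type*} [MeasurableSpace Ω] [MeasurableSpace X]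
    (τ : E d → X → X) (M : Ω → X) (P : Measure Ω) : Prop where
  measurable : Measurable M
  measurable_shift : ∀ v, Measurable fun ω => τ v (M ω)
  map_shift : ∀ v, P.map (fun ω => τ v (M ω)) = P.map M

/-- The stationary random element `M` is `α`-mixing:
`P(M ∈ A, τ_v M ∈ B) → P(M ∈ A) P(M ∈ B)` as `|v| → ∞`, for all measurable `A, B`. -/
structure IsAlphaMixing {d : ℕ} {Ω X : Type*} [MeasurableSpace Ω] [MeasurableSpace X]
    (τ : E d → X → X) (M : Ω → X) (P : Measure Ω) : Prop extends IsStationary τ M P where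
  mixing : ∀ A B : Set X, MeasurableSet A → MeasurableSet B →
    Tendsto (fun v : E d => P {ω | M ω ∈ A ∧ τ v (M ω) ∈ B}) (Bornology.cobounded (E d))
      (𝓝 (P {ω | M ω ∈ A} * P {ω | M ω ∈ B}))

/-- The stationary random element `M` is ergodic: every measurable set that is almost surely
invariant under each of the shifts has probability `0` or `1` under the law of `M`. -/
structure IsErgodic {d : ℕ} {Ω X : Type*} [MeasurableSpace Ω] [MeasurableSpace X]
    (τ : E d → X → X) (M : Ω → X) (P : Measure Ω) : Prop extends IsStationary τ M P where
  zero_one : ∀ A : Set X, MeasurableSet A →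
    (∀ v : E d, ∀ᵐ ω ∂P, (τ v (M ω) ∈ A ↔ M ω ∈ A)) →
    P {ω | M ω ∈ A} = 0 ∨ P {ω | M ω ∈ A} = 1

end ShotNoise

end

namespace ShotNoise

/-! Upper bounds on M at finitely many sites say exactly that Φ avoids the set `exceedance`. These
events form a π-system generating the product σ-field, so stationarity and mixing reduce to void
probabilities exp(-ν(C ∪ D_v)), where D_v is the translate of D by v. Translations preserve ν. If
ν(C) and ν(D) are finite, then ν(C ∩ D_v) → 0 and the exponential factorises in the limit; if one is
infinite, both sides are 0 (`tendsto_voidProb_union_translate`).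
`IsStationary.isAlphaMixing_of_isPiSystem` extends mixing to all events, and for an almost surely
invariant event mixing gives p = p².

For the paths, M is lower semicontinuous as a supremum of continuous functions. Almost surely M ≥ α⁻
everywhere (`ae_alphaMinus_le_shotNoise`), while above α⁺ only finitely many points matter on a unit
ball (`ae_finite_contributions`). When α⁻ = α⁺, every level r > M(y) is above α⁺, so near y only
finitely many continuous contributions can exceed r: this is upper semicontinuity. Mixing then
passes to the space of continuous functions because its Borel σ-field is generated by the
evaluations (`borel_continuousMap_eq_comap_coe`). -/

/-! ### The Borel σ-field of the compact-open topology -/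

/-- On `C(X, Y)`, sets of functions mapping `K` into a closed set are measurable for the `σ`-field
generated by the evaluations. -/
theorem measurableSet_comap_coe_mapsTo_isClosed {X Y : Type*} [TopologicalSpace X]
    [SecondCountableTopology X] [TopologicalSpace Y] [MeasurableSpace Y] [OpensMeasurableSpace Y]
    (K : Set X) {F : Set Y} (hF : IsClosed F) :
    MeasurableSet[MeasurableSpace.comap (fun f : C(X, Y) => (f : X → Y)) MeasurableSpace.pi]
      {f : C(X, Y) | MapsTo f K F} := by
  obtain ⟨D, hDc, hDd⟩ := TopologicalSpace.exists_countable_dense K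
  refine ⟨{f | ∀ y ∈ D, f y ∈ F}, ?_, ?_⟩
  · have : {f : X → Y | ∀ y ∈ D, f y ∈ F} = ⋂ y ∈ D, (fun f : X → Y => f y) ⁻¹' F := by
      ext; simp
    rw [this]
    exact MeasurableSet.biInter hDc fun y _ => measurable_pi_apply _ hF.measurableSet
  · ext f
    simp only [mem_preimage, mem_ofPred_eq]
    refine ⟨fun h x hx => ?_, fun h y _ => h y.2⟩
    have hcl : IsClosed {y : K | f y ∈ F} :=
      hF.preimage (f.continuous.comp continuous_subtype_val)
    have : closure D ⊆ {y : K | f y ∈ F} := closure_minimal (fun y hy => h y hy) hcl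
    exact this (hDd ⟨x, hx⟩)

/-- On `C(X, Y)`, sets of functions mapping a compact set into an open set are measurable for the
`σ`-field generated by the evaluations. -/
theorem measurableSet_comap_coe_mapsTo_isOpen {X Y : Type*} [TopologicalSpace X]
    [SecondCountableTopology X] [TopologicalSpace Y] [SecondCountableTopology Y] [RegularSpace Y]
    [MeasurableSpace Y] [OpensMeasurableSpace Y]
    {K : Set X} (hK : IsCompact K) {U : Set Y} (hU : IsOpen U) :
    MeasurableSet[MeasurableSpace.comap (fun f : C(X, Y) => (f : X → Y)) MeasurableSpace.pi]
      {f : C(X, Y) | MapsTo f K U} := by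
  set B : Set (Set Y) := {V ∈ TopologicalSpace.countableBasis Y | closure V ⊆ U} with hB
  have hBc : B.Countable := (TopologicalSpace.countable_countableBasis Y).mono fun V hV => hV.1
  have hSc : {s : Set (Set Y) | s.Finite ∧ s ⊆ B}.Countable := countable_ofPred_finite_subset hBc
  -- By regularity and compactness, the image of K is covered by finitely many basic sets with
  -- closure in U. There are only countably many such finite families, and closed targets are
  -- already settled.
  have key : {f : C(X, Y) | MapsTo f K U} =
      ⋃ s ∈ {s : Set (Set Y) | s.Finite ∧ s ⊆ B},
        {f : C(X, Y) | MapsTo f K (⋃ V ∈ s, closure V)} := by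
    ext f
    simp only [mem_ofPred_eq, mem_iUnion, exists_prop]
    constructor
    · intro hf
      obtain ⟨b, hbB, hbf, hb⟩ := (hK.image f.continuous).elim_finite_subcover_image (b := B)
        (c := id) (fun V hV => TopologicalSpace.isOpen_of_mem_countableBasis hV.1) (by
          rintro _ ⟨x, hx, rfl⟩
          obtain ⟨V, hV, hxV, hVU⟩ :=
            (TopologicalSpace.isBasis_countableBasis Y).exists_closure_subset
              (hU.mem_nhds (hf hx))
          exact mem_biUnion (show V ∈ B from ⟨hV, hVU⟩) hxV)
      refine ⟨b, ⟨hbf, hbB⟩, fun x hx => ?_⟩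
      have := hb (mem_image_of_mem f hx)
      simp only [mem_iUnion, id] at this ⊢
      obtain ⟨V, hV, hx⟩ := this
      exact ⟨V, hV, subset_closure hx⟩
    · rintro ⟨s, ⟨_, hs⟩, hf⟩ x hx
      have := hf hx
      simp only [mem_iUnion] at this
      obtain ⟨V, hV, hxV⟩ := this
      exact (hs hV).2 hxV
  rw [key]
  refine MeasurableSet.biUnion hSc fun s hs => ?_
  exact measurableSet_comap_coe_mapsTo_isClosed K
    (hs.1.isClosed_biUnion fun V _ => isClosed_closure)

/-- The Borel `σ`-field of the compact-open topology on `C(X, Y)` is generated by the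
evaluations. -/
theorem borel_continuousMap_eq_comap_coe {X Y : Type*} [TopologicalSpace X]
    [SecondCountableTopology X] [LocallyCompactSpace X] [TopologicalSpace Y]
    [SecondCountableTopology Y] [RegularSpace Y] [MeasurableSpace Y] [BorelSpace Y] :
    borel C(X, Y) = MeasurableSpace.comap (fun f : C(X, Y) => (f : X → Y)) MeasurableSpace.pi := by
  apply le_antisymm
  · rw [borel_eq_generateFrom_of_subbasis (ContinuousMap.compactOpen_eq (X := X) (Y := Y))]
    refine MeasurableSpace.generateFrom_le ?_
    rintro _ ⟨K, hK, U, hU, rfl⟩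
    exact measurableSet_comap_coe_mapsTo_isOpen hK hU
  · let _ : MeasurableSpace C(X, Y) := borel _
    have : BorelSpace C(X, Y) := ⟨rfl⟩
    refine Measurable.comap_le (measurable_pi_lambda _ fun x => ?_)
    exact (continuous_eval_const x).measurable

/-! ### A generating π-system for the product σ-field -/

/-- The sets `{f | f y ≤ t for all (y, t) ∈ F}`, `F` finite, of functions on `S`. -/
def lowerBox {S : Type*} (F : Finset (S × ℝ≥0∞)) : Set (S → ℝ≥0∞) :=
  {f | ∀ p ∈ F, f p.1 ≤ p.2}

theorem isPiSystem_range_lowerBox {S : Type*} :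
    IsPiSystem (range (lowerBox : Finset (S × ℝ≥0∞) → Set (S → ℝ≥0∞))) := by
  classical
  rintro _ ⟨F, rfl⟩ _ ⟨F', rfl⟩ _
  refine ⟨F ∪ F', ?_⟩
  ext f
  simp only [lowerBox, Finset.mem_union, mem_ofPred_eq, mem_inter_iff]
  exact ⟨fun h => ⟨fun p hp => h p (.inl hp), fun p hp => h p (.inr hp)⟩,
    fun h p hp => hp.elim (h.1 p) (h.2 p)⟩

theorem measurableSet_lowerBox {S : Type*} (F : Finset (S × ℝ≥0∞)) :
    MeasurableSet (lowerBox F) := by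
  have : lowerBox F = ⋂ p ∈ F, (fun f : S → ℝ≥0∞ => f p.1) ⁻¹' Iic p.2 := by
    ext; simp [lowerBox]
  rw [this]
  exact Finset.measurableSet_biInter _ fun p _ => measurable_pi_apply _ measurableSet_Iic

theorem pi_eq_generateFrom_lowerBox {S : Type*} :
    (MeasurableSpace.pi : MeasurableSpace (S → ℝ≥0∞)) =
      MeasurableSpace.generateFrom (range lowerBox) := by
  apply le_antisymm
  · refine iSup_le fun y => ?_
    rw [BorelSpace.measurable_eq (α := ℝ≥0∞), borel_eq_generateFrom_Iic,
      MeasurableSpace.comap_generateFrom]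
    refine MeasurableSpace.generateFrom_mono ?_
    rintro _ ⟨_, ⟨t, rfl⟩, rfl⟩
    exact ⟨{(y, t)}, by ext; simp [lowerBox]⟩
  · refine MeasurableSpace.generateFrom_le ?_
    rintro _ ⟨F, rfl⟩
    exact measurableSet_lowerBox F

/-! ### Mixing on a π-system, and ergodicity -/

theorem measureReal_iUnion_of_disjoint {X : Type*} [MeasurableSpace X] {μ : Measure X}
    [IsFiniteMeasure μ] {f : ℕ → Set X} (hdisj : Pairwise (Function.onFun Disjoint f))
    (hf : ∀ n, MeasurableSet (f n)) : μ.real (⋃ n, f n) = ∑' n, μ.real (f n) := by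
  rw [measureReal_def, measure_iUnion hdisj hf, ENNReal.tsum_toReal_eq fun _ => measure_ne_top _ _]
  rfl

/-- Asymptotic independence of `X i` from the events `F i` extends from a generating `π`-system
to the whole `σ`-field, provided the laws of the `X i` are all equal. -/
theorem tendsto_measureReal_inter_of_isPiSystem {Ω X ι : Type*} [MeasurableSpace Ω]
    [mX : MeasurableSpace X] {P : Measure Ω} [IsProbabilityMeasure P] {l : Filter ι}
    {S : Set (Set X)} (hgen : mX = MeasurableSpace.generateFrom S) (hS : IsPiSystem S)
    {Y : ι → Ω → X} (hY : ∀ i, Measurable (Y i)) {μ : Measure X} [IsProbabilityMeasure μ]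
    (hlaw : ∀ i, P.map (Y i) = μ) {F : ι → Set Ω} (hF : ∀ i, MeasurableSet (F i)) {c : ℝ}
    (hc : Tendsto (fun i => P.real (F i)) l (𝓝 c))
    (hbasic : ∀ A ∈ S, Tendsto (fun i => P.real (Y i ⁻¹' A ∩ F i)) l (𝓝 (μ.real A * c)))
    {A : Set X} (hA : MeasurableSet A) :
    Tendsto (fun i => P.real (Y i ⁻¹' A ∩ F i)) l (𝓝 (μ.real A * c)) := by
  induction A, hA using MeasurableSpace.induction_on_inter hgen hS with
  | empty => simpa using tendsto_const_nhds
  | basic t ht => exact hbasic t ht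
  | compl t ht ih =>
    have h1 : ∀ i, P.real (Y i ⁻¹' tᶜ ∩ F i) = P.real (F i) - P.real (Y i ⁻¹' t ∩ F i) := by
      intro i
      have := measureReal_sdiff_add_inter (μ := P) (s := F i) (t := Y i ⁻¹' t) (hY i ht)
      have e : Y i ⁻¹' tᶜ ∩ F i = F i \ Y i ⁻¹' t := by
        ext; simp [and_comm]
      rw [e, inter_comm (Y i ⁻¹' t)]
      linarith
    simp_rw [h1]
    have h2 : μ.real tᶜ * c = c - μ.real t * c := by
      rw [probReal_compl_eq_one_sub ht]; ring
    rw [h2]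
    exact hc.sub ih
  | iUnion f hdisj hfm ih =>
    have hsum : HasSum (fun n => μ.real (f n)) (μ.real (⋃ n, f n)) := by
      rw [measureReal_iUnion_of_disjoint hdisj hfm]
      exact (summable_measure_toReal hfm hdisj).hasSum
    have h1 : ∀ i, P.real (Y i ⁻¹' (⋃ n, f n) ∩ F i) = ∑' n, P.real (Y i ⁻¹' f n ∩ F i) := by
      intro i
      rw [preimage_iUnion, iUnion_inter, measureReal_iUnion_of_disjoint]
      · intro a b hab
        exact ((hdisj hab).preimage (Y i)).mono inter_subset_left inter_subset_left
      · exact fun n => (hY i (hfm n)).inter (hF i)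
    simp_rw [h1]
    rw [(hsum.mul_right c).tsum_eq.symm]
    -- The equality of the laws gives the dominating sequence `μ.real (f n)`, independent of `i`.
    refine tendsto_tsum_of_dominated_convergence hsum.summable ih (.of_forall fun i n => ?_)
    rw [Real.norm_of_nonneg measureReal_nonneg, ← hlaw i, map_measureReal_apply (hY i) (hfm n)]
    exact measureReal_mono inter_subset_left

/-- Mixing of a stationary random element can be checked on a generating `π`-system. -/
theorem IsStationary.isAlphaMixing_of_isPiSystem {d : ℕ} {Ω X : Type*} [MeasurableSpace Ω]
    [mX : MeasurableSpace X] {P : Measure Ω} [IsProbabilityMeasure P] {τ : E d → X → X}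
    {M : Ω → X} (hM : IsStationary τ M P)
    {S : Set (Set X)} (hgen : mX = MeasurableSpace.generateFrom S) (hS : IsPiSystem S)
    (hbasic : ∀ A ∈ S, ∀ B ∈ S, Tendsto (fun v => P.real {ω | M ω ∈ A ∧ τ v (M ω) ∈ B})
      (Bornology.cobounded (E d)) (𝓝 (P.real {ω | M ω ∈ A} * P.real {ω | M ω ∈ B}))) :
    IsAlphaMixing τ M P := by
  refine ⟨hM, fun A B hA hB => ?_⟩
  have := Measure.isProbabilityMeasure_map (μ := P) hM.measurable.aemeasurable
  have hreal : ∀ {A : Set X}, MeasurableSet A → (P.map M).real A = P.real {ω | M ω ∈ A} :=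
    fun hA => map_measureReal_apply hM.measurable hA
  have hSm : ∀ B ∈ S, MeasurableSet B := fun B hB => hgen ▸ .basic B hB
  have hshift : ∀ v, ∀ B, MeasurableSet B →
      P.real {ω | τ v (M ω) ∈ B} = P.real {ω | M ω ∈ B} := by
    intro v B hB
    rw [← hreal hB, ← hM.map_shift v, map_measureReal_apply (hM.measurable_shift v) hB]
    rfl
  -- The two events are extended one at a time: first A, with the shifted event from the π-system
  -- held as `F v`; then B, with `{M ∈ A}` as the constant `F`.
  have hleft : ∀ B ∈ S, Tendsto (fun v => P.real {ω | M ω ∈ A ∧ τ v (M ω) ∈ B})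
      (Bornology.cobounded (E d)) (𝓝 (P.real {ω | M ω ∈ A} * P.real {ω | M ω ∈ B})) := by
    intro B hB
    rw [← hreal hA]
    refine tendsto_measureReal_inter_of_isPiSystem hgen hS (Y := fun _ => M)
      (F := fun v => {ω | τ v (M ω) ∈ B}) (fun _ => hM.measurable) (fun _ => rfl)
      (fun v => hM.measurable_shift v (hSm B hB)) ?_ ?_ hA
    · simp_rw [hshift _ B (hSm B hB)]
      exact tendsto_const_nhds
    · intro A' hA'
      rw [hreal (hSm A' hA')]
      exact hbasic A' hA' B hB
  have hall : Tendsto (fun v => P.real {ω | M ω ∈ A ∧ τ v (M ω) ∈ B})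
      (Bornology.cobounded (E d)) (𝓝 (P.real {ω | M ω ∈ A} * P.real {ω | M ω ∈ B})) := by
    have := tendsto_measureReal_inter_of_isPiSystem (l := Bornology.cobounded (E d))
      hgen hS (Y := fun v ω => τ v (M ω))
      (F := fun _ => {ω | M ω ∈ A}) hM.measurable_shift hM.map_shift
      (fun v => hM.measurable hA) tendsto_const_nhds (A := B) ?_ hB
    · rw [hreal hB, mul_comm] at this
      refine this.congr fun v => ?_
      rw [inter_comm]
      rfl
    · intro B' hB'
      rw [hreal (hSm B' hB'), mul_comm]
      refine (hleft B' hB').congr fun v => ?_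
      rw [inter_comm]
      rfl
  rw [← ENNReal.tendsto_toReal_iff (fun _ => measure_ne_top _ _)
    (ENNReal.mul_ne_top (measure_ne_top _ _) (measure_ne_top _ _)), ENNReal.toReal_mul]
  exact hall

/-- Mixing implies ergodicity. -/
theorem IsAlphaMixing.isErgodic {d : ℕ} (hd : 1 ≤ d) {Ω X : Type*} [MeasurableSpace Ω]
    [MeasurableSpace X] {P : Measure Ω} [IsProbabilityMeasure P] {τ : E d → X → X}
    {M : Ω → X} (hM : IsAlphaMixing τ M P) : IsErgodic τ M P := by
  refine ⟨hM.toIsStationary, fun A hA hinv => ?_⟩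
  -- In positive dimension the space is unbounded, so the filter |v| → ∞ is nontrivial and limits
  -- along it are unique.
  have : Nonempty (Fin d) := ⟨⟨0, hd⟩⟩
  have : NeBot (Bornology.cobounded (E d)) := inferInstance
  have hlim := hM.mixing A A hA hA
  have hconst : ∀ v, P {ω | M ω ∈ A ∧ τ v (M ω) ∈ A} = P {ω | M ω ∈ A} := fun v =>
    measure_congr <| by
      filter_upwards [hinv v] with ω hω
      exact propext ⟨fun h => h.1, fun h => ⟨h, hω.2 h⟩⟩
  simp_rw [hconst] at hlim
  have hp := tendsto_nhds_unique tendsto_const_nhds hlim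
  by_cases h0 : P {ω | M ω ∈ A} = 0
  · exact .inl h0
  · exact .inr (((ENNReal.mul_eq_left h0 (measure_ne_top _ _)).1 hp.symm))

/-! ### Void probabilities and translations of the intensity -/

/-- Void probabilities of a Poisson process as a function of the intensity. -/
noncomputable def voidProb (t : ℝ≥0∞) : ℝ := if t = ∞ then 0 else Real.exp (-t.toReal)

theorem count_eq_zero_iff {S : Type*} {N B : Set S} : count N B = 0 ↔ ∀ q ∈ N, q ∉ B := by
  rw [count, encard_eq_zero, eq_empty_iff_forall_notMem]
  simp

theorem IsPoissonPointProcess.measureReal_count_eq_zero {Ω S : Type*} [MeasurableSpace Ω]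
    [TopologicalSpace S] [MeasurableSpace S] {Φ : Ω → Set S} {ν : Measure S} {P : Measure Ω}
    (hΦ : IsPoissonPointProcess Φ ν P) {B : Set S} (hB : MeasurableSet B) :
    P.real {ω | count (Φ ω) B = 0} = voidProb (ν B) := by
  unfold voidProb
  split_ifs with hν
  · have : P {ω | count (Φ ω) B = 0} = 0 := by
      refine measure_mono_null ?_ (ae_iff.1 (hΦ.count_eq_top B hB hν))
      intro ω (hω : _ = _)
      simp [hω]
    simp [measureReal_def, this]
  · have h1 : P {ω | count (Φ ω) B = 0} = P.map (fun ω => count (Φ ω) B) {0} :=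
      (Measure.map_apply (hΦ.measurable_count B hB) (measurableSet_singleton 0)).symm
    rw [measureReal_def, h1, hΦ.law_count B hB hν,
      Measure.map_apply .of_discrete (measurableSet_singleton 0)]
    have h2 : (Nat.cast : ℕ → ℕ∞) ⁻¹' {0} = {0} := by ext; simp
    rw [h2, poissonMeasure_singleton, ENNReal.toReal_ofReal (by positivity)]
    simp [ENNReal.toReal]

/-- The Poisson law is carried by ℕ, so its image in `ℕ∞` has no mass at `⊤`. -/
theorem IsPoissonPointProcess.ae_count_ne_top {Ω S : Type*} [MeasurableSpace Ω]
    [TopologicalSpace S] [MeasurableSpace S] {Φ : Ω → Set S} {ν : Measure S} {P : Measure Ω}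
    (hΦ : IsPoissonPointProcess Φ ν P) {B : Set S} (hB : MeasurableSet B) (hν : ν B ≠ ∞) :
    ∀ᵐ ω ∂P, count (Φ ω) B ≠ ⊤ := by
  rw [ae_iff]
  have h1 : P {ω | ¬ count (Φ ω) B ≠ ⊤} = P.map (fun ω => count (Φ ω) B) {⊤} := by
    rw [Measure.map_apply (hΦ.measurable_count B hB) (measurableSet_singleton ⊤)]
    congr 1
    ext; simp
  rw [h1, hΦ.law_count B hB hν, Measure.map_apply .of_discrete (measurableSet_singleton ⊤)]
  have h2 : (Nat.cast : ℕ → ℕ∞) ⁻¹' {⊤} = ∅ := by ext; simp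
  rw [h2, measure_empty]

theorem sigmaFinite_of_tail_lt_top {G : Measure Weight}
    (hG : ∀ u : ℝ, 0 < u → tail G (ENNReal.ofReal u) < ∞) : SigmaFinite G := by
  refine ⟨⟨⟨fun n : ℕ => {m | ENNReal.ofReal (1 / (n + 1)) < ENNReal.ofReal (m : ℝ)},
    fun _ => trivial, fun n => hG _ Nat.one_div_pos_of_nat, ?_⟩⟩⟩
  refine eq_univ_of_forall fun m => mem_iUnion.2 ?_
  obtain ⟨n, hn⟩ := exists_nat_one_div_lt (show (0 : ℝ) < m from m.2)
  exact ⟨n, (ENNReal.ofReal_lt_ofReal_iff m.2).2 hn⟩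

/-- Translation by `v` in the space variable. -/
def translate {d : ℕ} {W : Type*} (v : E d) (D : Set (E d × W)) : Set (E d × W) :=
  {q | (q.1 - v, q.2) ∈ D}

theorem measurePreserving_translate {d : ℕ} {W : Type*} [MeasurableSpace W] (G : Measure W)
    [SFinite G] (v : E d) :
    MeasurePreserving (fun q : E d × W => (q.1 - v, q.2)) ((volume : Measure (E d)).prod G)
      ((volume : Measure (E d)).prod G) :=
  (measurePreserving_sub_right volume v).prod (MeasurePreserving.id G)

theorem tendsto_measure_inter_norm_gt {d : ℕ} {W : Type*} [MeasurableSpace W]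
    {ν : Measure (E d × W)} {C : Set (E d × W)} (hC : MeasurableSet C) (hν : ν C ≠ ∞) :
    Tendsto (fun n : ℕ => ν (C ∩ {q | (n : ℝ) < ‖q.1‖})) atTop (𝓝 0) := by
  have hlim := tendsto_measure_iInter_atTop (μ := ν)
    (s := fun n : ℕ => C ∩ {q : E d × W | (n : ℝ) < ‖q.1‖})
    (fun n => (hC.inter (measurableSet_lt measurable_const
      measurable_fst.norm)).nullMeasurableSet) (fun a b hab q hq => ⟨hq.1, ?_⟩)
    ⟨0, measure_ne_top_of_subset inter_subset_left hν⟩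
  · have hempty : ⋂ n : ℕ, C ∩ {q : E d × W | (n : ℝ) < ‖q.1‖} = ∅ := by
      refine eq_empty_of_forall_notMem fun q hq => ?_
      obtain ⟨n, hn⟩ := exists_nat_ge ‖q.1‖
      exact absurd (mem_iInter.1 hq n).2 (not_lt.2 hn)
    rwa [hempty, measure_empty] at hlim
  · exact lt_of_le_of_lt (Nat.cast_le.2 hab) (mem_ofPred_eq ▸ hq.2)

/-- Two sets of finite measure become asymptotically disjoint under translations. -/
theorem tendsto_measure_inter_translate {d : ℕ} {W : Type*} [MeasurableSpace W] (G : Measure W)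
    [SFinite G] {C D : Set (E d × W)} (hC : MeasurableSet C) (hD : MeasurableSet D)
    (hCν : ((volume : Measure (E d)).prod G) C ≠ ∞)
    (hDν : ((volume : Measure (E d)).prod G) D ≠ ∞) :
    Tendsto (fun v => ((volume : Measure (E d)).prod G) (C ∩ translate v D))
      (Bornology.cobounded (E d)) (𝓝 0) := by
  rw [ENNReal.tendsto_nhds_zero]
  intro ε hε
  have hsum := (tendsto_measure_inter_norm_gt hC hCν).add (tendsto_measure_inter_norm_gt hD hDν)
  rw [add_zero] at hsum
  obtain ⟨n, hn⟩ := (ENNReal.tendsto_nhds_zero.1 hsum ε hε).exists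
  have hv : ∀ᶠ v : E d in Bornology.cobounded (E d), (2 * n : ℝ) < ‖v‖ :=
    tendsto_norm_cobounded_atTop.eventually_gt_atTop _
  filter_upwards [hv] with v hv
  refine le_trans ?_ hn
  -- If x and x - v both had norm at most n, then ‖v‖ ≤ 2n; so one of them lies in the tail of C or
  -- of D.
  have hsub : C ∩ translate v D ⊆ (C ∩ {q | (n : ℝ) < ‖q.1‖}) ∪
      (fun q : E d × W => (q.1 - v, q.2)) ⁻¹' (D ∩ {q | (n : ℝ) < ‖q.1‖}) := by
    rintro q ⟨hqC, hqD⟩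
    by_cases hq : (n : ℝ) < ‖q.1‖
    · exact .inl ⟨hqC, hq⟩
    · refine .inr ⟨hqD, ?_⟩
      have h1 : ‖v‖ ≤ ‖q.1‖ + ‖q.1 - v‖ := by
        simpa using norm_sub_le q.1 (q.1 - v)
      change (n : ℝ) < ‖q.1 - v‖
      linarith
  refine (measure_mono hsub).trans ((measure_union_le _ _).trans_eq ?_)
  rw [(measurePreserving_translate G v).measure_preimage
    (hD.inter (measurableSet_lt measurable_const measurable_fst.norm)).nullMeasurableSet]

/-- This is asymptotic independence of the avoidance events. For finite measures,
inclusion-exclusion leaves only the vanishing overlap in the exponent. -/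
theorem tendsto_voidProb_union_translate {d : ℕ} {W : Type*} [MeasurableSpace W] (G : Measure W)
    [SFinite G] {C D : Set (E d × W)} (hC : MeasurableSet C) (hD : MeasurableSet D) :
    Tendsto (fun v => voidProb (((volume : Measure (E d)).prod G) (C ∪ translate v D)))
      (Bornology.cobounded (E d))
      (𝓝 (voidProb (((volume : Measure (E d)).prod G) C) *
        voidProb (((volume : Measure (E d)).prod G) D))) := by
  set ν := (volume : Measure (E d)).prod G with hν
  have hDv : ∀ v, ν (translate v D) = ν D := fun v =>
    (measurePreserving_translate G v).measure_preimage hD.nullMeasurableSet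
  by_cases hCt : ν C = ∞
  · have : ∀ v, ν (C ∪ translate v D) = ∞ := fun v => measure_mono_top subset_union_left hCt
    simpa [voidProb, this, hCt] using tendsto_const_nhds
  by_cases hDt : ν D = ∞
  · have : ∀ v, ν (C ∪ translate v D) = ∞ := fun v =>
      measure_mono_top subset_union_right ((hDv v).trans hDt)
    simpa [voidProb, this, hDt] using tendsto_const_nhds
  have hDvt : ∀ v, ν (translate v D) ≠ ∞ := fun v => by rwa [hDv v]
  have hU : ∀ v, ν (C ∪ translate v D) ≠ ∞ := fun v => measure_union_ne_top hCt (hDvt v)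
  simp only [voidProb, hU, hCt, hDt, if_false]
  have hlim := (ENNReal.tendsto_toReal ENNReal.zero_ne_top).comp
    (tendsto_measure_inter_translate G hC hD hCt hDt)
  have heq : ∀ v, -(ν (C ∪ translate v D)).toReal =
      (ν (C ∩ translate v D)).toReal + (-(ν C).toReal + -(ν D).toReal) := by
    intro v
    have hm : MeasurableSet (translate v D) := (measurePreserving_translate G v).measurable hD
    have := measureReal_union_add_inter (μ := ν) (s := C) hm hCt (hDvt v)
    simp only [measureReal_def, hDv v] at this
    linarith
  simp_rw [heq]
  rw [← Real.exp_add]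
  refine (Real.continuous_exp.tendsto _).comp ?_
  simpa using hlim.add_const (-(ν C).toReal + -(ν D).toReal)

/-! ### Mixing in the product space -/

/-- The set of points which make the shot noise violate a bound `M(y) ≤ t`, `(y, t) ∈ F`. -/
def exceedance {d : ℕ} (h : E d → ℝ≥0∞) (F : Finset (E d × ℝ≥0∞)) : Set (E d × Weight) :=
  {q | ∃ p ∈ F, p.2 < ENNReal.ofReal (q.2 : ℝ) * h (p.1 - q.1)}

theorem measurableSet_lt_mul {d : ℕ} {g : E d → ℝ≥0∞} (hg : Measurable g) (y : E d)
    (t : ℝ≥0∞) :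
    MeasurableSet {q : E d × Weight | t < ENNReal.ofReal (q.2 : ℝ) * g (y - q.1)} :=
  measurableSet_lt measurable_const (by fun_prop)

theorem measurableSet_exceedance {d : ℕ} {h : E d → ℝ≥0∞} (hh : Measurable h)
    (F : Finset (E d × ℝ≥0∞)) : MeasurableSet (exceedance h F) := by
  have : exceedance h F =
      ⋃ p ∈ F, {q : E d × Weight | p.2 < ENNReal.ofReal (q.2 : ℝ) * h (p.1 - q.1)} := by
    ext; simp [exceedance]
  rw [this]
  exact Finset.measurableSet_biUnion _ fun p _ => measurableSet_lt_mul hh _ _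

/-- Since y + v - x = y - (x - v), shifting the field by v amounts to moving every point x to x - v.
-/
theorem shift_shotNoise_mem_lowerBox_iff {d : ℕ} {h : E d → ℝ≥0∞} {N : Set (E d × Weight)}
    {F : Finset (E d × ℝ≥0∞)} (v : E d) :
    shift v (shotNoise h N) ∈ lowerBox F ↔ ∀ q ∈ N, q ∉ translate v (exceedance h F) := by
  have e : ∀ y x : E d, y + v - x = y - (x - v) := fun y x => by abel
  simp only [lowerBox, shift, shotNoise, exceedance, translate, mem_ofPred_eq, iSup_le_iff,
    not_exists, not_and, not_lt, e]
  exact ⟨fun H q hq p hp => H p hp q hq, fun H p hp q hq => H q hq p hp⟩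

theorem shift_zero {d : ℕ} (f : E d → ℝ≥0∞) : shift 0 f = f := by
  ext; simp [shift]

theorem translate_zero {d : ℕ} {W : Type*} (D : Set (E d × W)) : translate 0 D = D := by
  ext; simp [translate]

theorem shotNoise_mem_lowerBox_iff {d : ℕ} {h : E d → ℝ≥0∞} {N : Set (E d × Weight)}
    {F : Finset (E d × ℝ≥0∞)} :
    shotNoise h N ∈ lowerBox F ↔ ∀ q ∈ N, q ∉ exceedance h F := by
  simpa [shift_zero, translate_zero] using
    shift_shotNoise_mem_lowerBox_iff (h := h) (N := N) (F := F) 0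

theorem measurable_shift {d : ℕ} (v : E d) : Measurable (shift v : (E d → ℝ≥0∞) → _) :=
  measurable_pi_lambda _ fun y => measurable_pi_apply (y + v)

theorem isAlphaMixing_shotNoise {d : ℕ} {Ω : Type*} [MeasurableSpace Ω] {P : Measure Ω}
    [IsProbabilityMeasure P] {G : Measure Weight} [SFinite G] {h : E d → ℝ≥0∞}
    (hh : Measurable h) {Φ : Ω → Set (E d × Weight)}
    (hΦ : IsPoissonPointProcess Φ ((volume : Measure (E d)).prod G) P) :
    IsAlphaMixing shift (fun ω => shotNoise h (Φ ω)) P := by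
  set ν := (volume : Measure (E d)).prod G with hν
  have hCm := measurableSet_exceedance hh
  have htm : ∀ v F, MeasurableSet (translate v (exceedance h F)) := fun v F =>
    (measurePreserving_translate G v).measurable (hCm F)
  have hbox : ∀ F, {ω | shotNoise h (Φ ω) ∈ lowerBox F} =
      {ω | count (Φ ω) (exceedance h F) = 0} := fun F => by
    ext ω
    simp only [mem_ofPred_eq, count_eq_zero_iff, shotNoise_mem_lowerBox_iff]
  have hboxv : ∀ v F, {ω | shift v (shotNoise h (Φ ω)) ∈ lowerBox F} =
      {ω | count (Φ ω) (translate v (exceedance h F)) = 0} := fun v F => by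
    ext ω
    simp only [mem_ofPred_eq, count_eq_zero_iff, shift_shotNoise_mem_lowerBox_iff]
  have hmeas : Measurable fun ω => shotNoise h (Φ ω) := by
    rw [pi_eq_generateFrom_lowerBox]
    refine measurable_generateFrom ?_
    rintro _ ⟨F, rfl⟩
    change MeasurableSet {ω | shotNoise h (Φ ω) ∈ lowerBox F}
    rw [hbox F]
    exact hΦ.measurable_count _ (hCm F) (measurableSet_singleton 0)
  have hstat : IsStationary shift (fun ω => shotNoise h (Φ ω)) P := by
    refine ⟨hmeas, fun v => (measurable_shift v).comp hmeas, fun v => ?_⟩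
    have hv : Measurable fun ω => shift v (shotNoise h (Φ ω)) := (measurable_shift v).comp hmeas
    have := Measure.isProbabilityMeasure_map (μ := P) hmeas.aemeasurable
    have := Measure.isProbabilityMeasure_map (μ := P) hv.aemeasurable
    refine ext_of_generate_finite _ pi_eq_generateFrom_lowerBox isPiSystem_range_lowerBox ?_
      (by simp)
    rintro _ ⟨F, rfl⟩
    rw [Measure.map_apply hmeas (measurableSet_lowerBox F),
      Measure.map_apply hv (measurableSet_lowerBox F), ← measureReal_eq_measureReal_iff]
    change P.real {ω | shift v (shotNoise h (Φ ω)) ∈ lowerBox F} =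
      P.real {ω | shotNoise h (Φ ω) ∈ lowerBox F}
    rw [hbox, hboxv, hΦ.measureReal_count_eq_zero (hCm F),
      hΦ.measureReal_count_eq_zero (htm v F)]
    congr 1
    exact (measurePreserving_translate G v).measure_preimage (hCm F).nullMeasurableSet
  refine hstat.isAlphaMixing_of_isPiSystem pi_eq_generateFrom_lowerBox
    isPiSystem_range_lowerBox ?_
  rintro _ ⟨F, rfl⟩ _ ⟨F', rfl⟩
  rw [hbox, hbox, hΦ.measureReal_count_eq_zero (hCm F), hΦ.measureReal_count_eq_zero (hCm F')]
  refine (tendsto_voidProb_union_translate G (hCm F) (hCm F')).congr fun v => ?_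
  rw [← hΦ.measureReal_count_eq_zero ((hCm F).union (htm v F'))]
  congr 1
  ext ω
  simp only [mem_ofPred_eq, count_eq_zero_iff, shift_shotNoise_mem_lowerBox_iff,
    shotNoise_mem_lowerBox_iff, mem_union, not_or]
  exact ⟨fun H => ⟨fun q hq => (H q hq).1, fun q hq => (H q hq).2⟩,
    fun H q hq => ⟨H.1 q hq, H.2 q hq⟩⟩

/-! ### The coefficient α and the intensity above a level -/

theorem tail_div_mono {G : Measure Weight} {u v : ℝ≥0∞} (huv : u ≤ v) (a : ℝ≥0∞) :
    tail G (v / a) ≤ tail G (u / a) :=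
  measure_mono fun _ hm => lt_of_le_of_lt (ENNReal.div_le_div_right huv a) hm

theorem lintegral_tail_of_lt_alpha {d : ℕ} {g : E d → ℝ≥0∞} {G : Measure Weight} {u : ℝ≥0∞}
    (hu : 0 < u) (h : u < alpha g G) : ∫⁻ x, tail G (u / g x) = ∞ := by
  by_contra hne
  exact notMem_of_lt_csInf h (OrderBot.bddBelow _) ⟨hu, h.trans_le le_top, lt_top_iff_ne_top.2 hne⟩

theorem lintegral_tail_of_alpha_lt {d : ℕ} {g : E d → ℝ≥0∞} {G : Measure Weight} {u : ℝ≥0∞}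
    (h : alpha g G < u) : ∫⁻ x, tail G (u / g x) < ∞ := by
  obtain ⟨v, ⟨_, _, hv⟩, hvu⟩ := sInf_lt_iff.1 h
  exact (lintegral_mono fun x => tail_div_mono hvu.le _).trans_lt hv

/-- The intensity of the points whose contribution at `y` exceeds the level `u`. -/
theorem prod_setOf_lt_mul {d : ℕ} {G : Measure Weight} [SFinite G] {g : E d → ℝ≥0∞}
    (hg : Measurable g) (y : E d) {u : ℝ≥0∞} (hu : u ≠ 0) (hu' : u ≠ ∞) :
    ((volume : Measure (E d)).prod G)
      {q : E d × Weight | u < ENNReal.ofReal (q.2 : ℝ) * g (y - q.1)} =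
      ∫⁻ x, tail G (u / g x) := by
  rw [Measure.prod_apply (measurableSet_lt_mul hg y u),
    ← lintegral_sub_left_eq_self (μ := (volume : Measure (E d))) (fun x => tail G (u / g x)) y]
  refine lintegral_congr fun x => ?_
  rw [tail]
  congr 1
  ext m
  -- As u is neither 0 nor ∞, the division conventions agree with multiplication even where g is 0
  -- or ∞.
  exact (ENNReal.div_lt_iff (.inr hu) (.inr hu')).symm

/-- An uncountable supremum of continuous functions is still lower semicontinuous. -/
theorem measurable_hPlus {d : ℕ} {h : E d → ℝ≥0∞} (hh : Continuous h) : Measurable (hPlus h) :=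
  (lowerSemicontinuous_biSup fun z _ =>
    (hh.comp (continuous_add_const z)).lowerSemicontinuous).measurable

theorem measurable_hMinus {d : ℕ} {h : E d → ℝ≥0∞} (hh : Continuous h) (ε : ℝ) :
    Measurable (hMinus h ε) :=
  (upperSemicontinuous_biInf fun z _ =>
    (hh.comp (continuous_add_const z)).upperSemicontinuous).measurable

theorem le_hPlus {d : ℕ} (h : E d → ℝ≥0∞) {x y : E d} (hxy : ‖y - x‖ ≤ 1) : h y ≤ hPlus h x := by
  have := le_biSup (fun z => h (x + z)) (show y - x ∈ {z : E d | ‖z‖ ≤ 1} from hxy)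
  rwa [add_sub_cancel] at this

theorem hMinus_le {d : ℕ} (h : E d → ℝ≥0∞) {ε : ℝ} {x y : E d} (hxy : ‖y - x‖ ≤ ε) :
    hMinus h ε x ≤ h y := by
  have := biInf_le (fun z => h (x + z)) (show y - x ∈ {z : E d | ‖z‖ ≤ ε} from hxy)
  rwa [add_sub_cancel] at this

theorem alpha_hMinus_anti {d : ℕ} (h : E d → ℝ≥0∞) (G : Measure Weight) :
    Antitone fun ε : ℝ => alpha (hMinus h ε) G := fun a _ hab =>
  alpha_mono (fun _ => biInf_mono fun z (hz : ‖z‖ ≤ a) => hz.trans hab) G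

theorem mul_le_shotNoise {d : ℕ} (h : E d → ℝ≥0∞) {N : Set (E d × Weight)} {q : E d × Weight}
    (hq : q ∈ N) (y : E d) : ENNReal.ofReal (q.2 : ℝ) * h (y - q.1) ≤ shotNoise h N y :=
  le_biSup (fun q : E d × Weight => ENNReal.ofReal (q.2 : ℝ) * h (y - q.1)) hq

theorem continuous_contribution {d : ℕ} {h : E d → ℝ≥0∞} (hh : Continuous h)
    (q : E d × Weight) : Continuous fun y => ENNReal.ofReal (q.2 : ℝ) * h (y - q.1) :=
  (ENNReal.continuous_const_mul ENNReal.ofReal_ne_top).comp (hh.comp (continuous_sub_right q.1))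

theorem lowerSemicontinuous_shotNoise {d : ℕ} {h : E d → ℝ≥0∞} (hh : Continuous h)
    (N : Set (E d × Weight)) : LowerSemicontinuous (shotNoise h N) :=
  lowerSemicontinuous_biSup fun q _ => (continuous_contribution hh q).lowerSemicontinuous

/-! ### Continuity of the paths -/

section Paths

variable {d : ℕ} {Ω : Type*} [MeasurableSpace Ω] {P : Measure Ω} {G : Measure Weight} [SFinite G]
  {h : E d → ℝ≥0∞} {Φ : Ω → Set (E d × Weight)}

/-- Almost surely, the shot noise is everywhere at least `α⁻(h, G)`. -/
theorem ae_alphaMinus_le_shotNoise (hh : Continuous h)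
    (hΦ : IsPoissonPointProcess Φ ((volume : Measure (E d)).prod G) P) :
    ∀ᵐ ω ∂P, ∀ y, alphaMinus h G ≤ shotNoise h (Φ ω) y := by
  -- Levels, radii and centres are made countable so that one null event serves all y. Below α the
  -- intensity is infinite, hence so is the count, and in particular a point exists.
  have hae : ∀ᵐ ω ∂P, ∀ (r : ℚ) (n k : ℕ), 0 < (Real.toNNReal r : ℝ≥0∞) →
      (Real.toNNReal r : ℝ≥0∞) < alpha (hMinus h (1 / (n + 1))) G →
      ∃ q ∈ Φ ω, (Real.toNNReal r : ℝ≥0∞) <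
        ENNReal.ofReal (q.2 : ℝ) * hMinus h (1 / (n + 1))
          (TopologicalSpace.denseSeq (E d) k - q.1) := by
    simp only [ae_all_iff]
    intro r n k hr hlt
    have hm := measurable_hMinus hh (1 / (n + 1))
    filter_upwards [hΦ.count_eq_top _ (measurableSet_lt_mul hm
      (TopologicalSpace.denseSeq (E d) k) (Real.toNNReal r))
      ((prod_setOf_lt_mul hm _ hr.ne' ENNReal.coe_ne_top).trans
        (lintegral_tail_of_lt_alpha hr hlt))] with ω hω
    by_contra! hcon
    have h0 := count_eq_zero_iff.2 fun q hq hqB => absurd (hcon q hq) (not_le.2 hqB)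
    exact absurd (h0.symm.trans hω) (by simp)
  filter_upwards [hae] with ω hω y
  refine le_of_forall_lt fun c hc => ?_
  obtain ⟨ε, hε, hcε⟩ := lt_biSup_iff.1 hc
  obtain ⟨n, hn⟩ := exists_nat_one_div_lt (show (0 : ℝ) < ε from hε)
  obtain ⟨r, _, hcr, hrα⟩ := ENNReal.lt_iff_exists_rat_btwn.1
    (hcε.trans_le (alpha_hMinus_anti h G hn.le))
  -- The centre is within the radius of the infimum defining `hMinus`, so a point exceeding r there
  -- also exceeds r at y.
  obtain ⟨_, hy, k, rfl⟩ := Metric.dense_iff.1 (TopologicalSpace.denseRange_denseSeq (E d)) y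
    (1 / (n + 1)) Nat.one_div_pos_of_nat
  obtain ⟨q, hq, hlt⟩ := hω r n k ((zero_le).trans_lt hcr) hrα
  refine hcr.trans (hlt.trans_le (le_trans ?_ (mul_le_shotNoise h hq y)))
  gcongr
  refine hMinus_le h ?_
  rw [sub_sub_sub_cancel_right, ← dist_eq_norm, dist_comm]
  exact (Metric.mem_ball.1 hy).le

/-- Almost surely, at levels above `α⁺(h, G)` only finitely many points contribute locally. -/
theorem ae_finite_contributions (hh : Continuous h)
    (hΦ : IsPoissonPointProcess Φ ((volume : Measure (E d)).prod G) P) :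
    ∀ᵐ ω ∂P, ∀ (r : ℚ) (k : ℕ), alphaPlus h G < (Real.toNNReal r : ℝ≥0∞) →
      (Φ ω ∩ {q | (Real.toNNReal r : ℝ≥0∞) <
        ENNReal.ofReal (q.2 : ℝ) * hPlus h (TopologicalSpace.denseSeq (E d) k - q.1)}).Finite := by
  simp only [ae_all_iff]
  intro r k hr
  have hm := measurable_hPlus hh
  filter_upwards [hΦ.ae_count_ne_top (measurableSet_lt_mul hm
    (TopologicalSpace.denseSeq (E d) k) (Real.toNNReal r))
    ((prod_setOf_lt_mul hm _ ((zero_le).trans_lt hr).ne' ENNReal.coe_ne_top).trans_lt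
      (lintegral_tail_of_alpha_lt hr)).ne] with ω hω
  exact encard_ne_top_iff.1 hω

theorem ae_continuous_shotNoise (hh : Continuous h) (hα : alphaMinus h G = alphaPlus h G)
    (hΦ : IsPoissonPointProcess Φ ((volume : Measure (E d)).prod G) P) :
    ∀ᵐ ω ∂P, Continuous (shotNoise h (Φ ω)) := by
  filter_upwards [ae_alphaMinus_le_shotNoise hh hΦ, ae_finite_contributions hh hΦ] with ω hlow hfin
  refine continuous_iff_lower_upperSemicontinuous.2
    ⟨lowerSemicontinuous_shotNoise hh _, fun y c hc => ?_⟩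
  obtain ⟨r, _, hr, hrc⟩ := ENNReal.lt_iff_exists_rat_btwn.1 hc
  obtain ⟨_, hy, k, rfl⟩ := Metric.dense_iff.1 (TopologicalSpace.denseRange_denseSeq (E d)) y
    1 one_pos
  set y₀ := TopologicalSpace.denseSeq (E d) k
  -- Here α⁻ = α⁺ enters: r > M(y) ≥ α⁻ puts r above α⁺.
  have hF := hfin r k ((hα ▸ hlow y).trans_lt hr)
  have hev : ∀ᶠ y' in 𝓝 y, ∀ q ∈ Φ ω ∩ {q | (Real.toNNReal r : ℝ≥0∞) <
      ENNReal.ofReal (q.2 : ℝ) * hPlus h (y₀ - q.1)},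
      ENNReal.ofReal (q.2 : ℝ) * h (y' - q.1) < Real.toNNReal r :=
    (eventually_all_finite hF).2 fun q hq =>
      (continuous_contribution hh q).tendsto y |>.eventually_lt_const
        ((mul_le_shotNoise h hq.1 y).trans_lt hr)
  filter_upwards [hev, Metric.isOpen_ball.mem_nhds (Metric.mem_ball_comm.1 hy)] with y' hy' hball
  refine lt_of_le_of_lt (iSup₂_le fun q hq => ?_) hrc
  -- The finitely many large points are controlled by continuity at y; any other stays at or below r
  -- on the whole unit ball around `y₀`, by the choice of `hPlus`.
  by_cases hqB : (Real.toNNReal r : ℝ≥0∞) < ENNReal.ofReal (q.2 : ℝ) * hPlus h (y₀ - q.1)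
  · exact (hy' q ⟨hq, hqB⟩).le
  · refine le_trans ?_ (not_lt.1 hqB)
    gcongr
    refine le_hPlus h ?_
    rw [sub_sub_sub_cancel_right, ← dist_eq_norm]
    exact (Metric.mem_ball.1 hball).le

end Paths

/-! ### Transfer to the space of continuous functions -/

/-- A stationary mixing random field with almost surely continuous paths has a modification that
is mixing as a random element of the space of continuous functions. -/
theorem IsAlphaMixing.exists_continuousMap {d : ℕ} {Ω : Type*} [MeasurableSpace Ω]
    {P : Measure Ω} {M : Ω → E d → ℝ≥0∞}
    (hM : IsAlphaMixing shift M P) (hcont : ∀ᵐ ω ∂P, Continuous (M ω)) :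
    ∃ M' : Ω → C(E d, ℝ≥0∞), (∀ᵐ ω ∂P, ⇑(M' ω) = M ω) ∧ IsAlphaMixing shiftC M' P := by
  classical
  -- The set of discontinuous paths need not be an event; replacing it by a measurable null superset
  -- keeps the modification measurable.
  obtain ⟨N, hN, hNm, hN0⟩ := exists_measurable_superset_of_null (ae_iff.1 hcont)
  have hNc : ∀ ω ∉ N, Continuous (M ω) := fun ω hω => by
    by_contra hn
    exact hω (hN hn)
  set M' : Ω → C(E d, ℝ≥0∞) := fun ω => if hω : ω ∈ N then 0 else ⟨M ω, hNc ω hω⟩ with hM'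
  have hcoe : ∀ ω, ⇑(M' ω) = if ω ∈ N then 0 else M ω := fun ω => by
    by_cases hω : ω ∈ N <;> simp [hM', hω]
  have hae : ∀ᵐ ω ∂P, ⇑(M' ω) = M ω := by
    filter_upwards [measure_eq_zero_iff_ae_notMem.1 hN0] with ω hω
    rw [hcoe, if_neg hω]
  have hσ : instMeasurableSpaceC d =
      MeasurableSpace.comap (fun f : C(E d, ℝ≥0∞) => (f : E d → ℝ≥0∞)) MeasurableSpace.pi :=
    borel_continuousMap_eq_comap_coe
  have hset : ∀ A : Set C(E d, ℝ≥0∞), MeasurableSet A →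
      ∃ A' : Set (E d → ℝ≥0∞), MeasurableSet A' ∧ ∀ f : C(E d, ℝ≥0∞), f ∈ A ↔ ⇑f ∈ A' := by
    intro A hA
    rw [hσ] at hA
    obtain ⟨A', hA', rfl⟩ := hA
    exact ⟨A', hA', fun f => Iff.rfl⟩
  have hshift : ∀ (v : E d) (f : C(E d, ℝ≥0∞)), ⇑(shiftC v f) = shift v f := fun _ _ => rfl
  have hmeas_coe : Measurable fun ω => ⇑(M' ω) := by
    simp_rw [hcoe]
    exact Measurable.ite hNm measurable_const hM.measurable
  have hmeas : Measurable M' := by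
    rw [hσ]
    exact measurable_comap_iff.2 hmeas_coe
  have hmeas_shift : ∀ v, Measurable fun ω => shiftC v (M' ω) := fun v => by
    rw [hσ]
    exact measurable_comap_iff.2 ((measurable_shift v).comp hmeas_coe)
  have hlaw : ∀ (S : Set C(E d, ℝ≥0∞)) (S' : Set (E d → ℝ≥0∞)), (∀ f, f ∈ S ↔ ⇑f ∈ S') →
      P {ω | M' ω ∈ S} = P {ω | M ω ∈ S'} := fun S S' hSS' =>
    measure_congr <| by
      filter_upwards [hae] with ω hω
      refine propext ((hSS' _).trans ?_)
      rw [hω]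
      rfl
  refine ⟨M', hae, ⟨hmeas, hmeas_shift, fun v => ?_⟩, fun A B hA hB => ?_⟩
  · ext A hA
    obtain ⟨A', hA', hAA'⟩ := hset A hA
    rw [Measure.map_apply hmeas hA, Measure.map_apply (hmeas_shift v) hA]
    have h1 : P ((fun ω => shiftC v (M' ω)) ⁻¹' A) = P ((fun ω => shift v (M ω)) ⁻¹' A') :=
      measure_congr <| by
        filter_upwards [hae] with ω hω
        refine propext ((hAA' _).trans ?_)
        rw [hshift, hω]
        rfl
    change _ = P {ω | M' ω ∈ A}
    rw [h1, hlaw A A' hAA', ← Measure.map_apply (hM.measurable_shift v) hA', hM.map_shift v,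
      Measure.map_apply hM.measurable hA']
    rfl
  · obtain ⟨A', hA', hAA'⟩ := hset A hA
    obtain ⟨B', hB', hBB'⟩ := hset B hB
    have h1 : ∀ v, P {ω | M' ω ∈ A ∧ shiftC v (M' ω) ∈ B} =
        P {ω | M ω ∈ A' ∧ shift v (M ω) ∈ B'} := fun v =>
      measure_congr <| by
        filter_upwards [hae] with ω hω
        refine propext ((and_congr (hAA' _) (hBB' _)).trans ?_)
        rw [hshift, hω]
        rfl
    simp_rw [h1, hlaw A A' hAA', hlaw B B' hBB']
    exact hM.mixing A' B' hA' hB'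

end ShotNoise

theorem proposition2p8 {d : ℕ} (hd : 1 ≤ d)
    {Ω : Type*} [MeasurableSpace Ω] (P : Measure Ω) [IsProbabilityMeasure P]
    (G : Measure ShotNoise.Weight)
    (hG : ∀ u : ℝ, 0 < u → ShotNoise.tail G (ENNReal.ofReal u) < ∞)
    (h : ShotNoise.E d → ℝ≥0∞) (hh : Measurable h)
    (Φ : Ω → Set (ShotNoise.E d × ShotNoise.Weight))
    (hΦ : ShotNoise.IsPoissonPointProcess Φ ((volume : Measure (ShotNoise.E d)).prod G) P)
    (M : Ω → ShotNoise.E d → ℝ≥0∞) (hM : ∀ ω, M ω = ShotNoise.shotNoise h (Φ ω)) :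
    (ShotNoise.IsAlphaMixing ShotNoise.shift M P ∧
      ShotNoise.IsErgodic ShotNoise.shift M P) ∧
    (Continuous h → ShotNoise.alphaMinus h G = ShotNoise.alphaPlus h G →
      (∀ᵐ ω ∂P, Continuous (M ω)) ∧
      ∃ M' : Ω → C(ShotNoise.E d, ℝ≥0∞),
        (∀ᵐ ω ∂P, ⇑(M' ω) = M ω) ∧
        ShotNoise.IsAlphaMixing ShotNoise.shiftC M' P ∧
        ShotNoise.IsErgodic ShotNoise.shiftC M' P) := by
  have := ShotNoise.sigmaFinite_of_tail_lt_top hG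
  obtain rfl : M = fun ω => ShotNoise.shotNoise h (Φ ω) := funext hM
  have hmix := ShotNoise.isAlphaMixing_shotNoise hh hΦ
  refine ⟨⟨hmix, hmix.isErgodic hd⟩, fun hc hα => ?_⟩
  have hcont := ShotNoise.ae_continuous_shotNoise hc hα hΦ
  obtain ⟨M', hM', hmix'⟩ := hmix.exists_continuousMap hcont
  exact ⟨hcont, M', hM', hmix', hmix'.isErgodic hd⟩
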